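/- All Banach spaces are real. Let $M$ be a complete metric space with a distinguished point $0\in M$ and let $Y$ be a Banach space. Let $\mathrm{Lip}(M,Y)$ be the space of Lipschitz maps $F\colon M\to Y$ with $F(0)=0$, normed by $$\|F\|_L=\sup\Big\{\tfrac{\|F(p)-F(q)\|}{d(p,q)} : p,q\in M,\ p\ne q\Big\}$$ (with $\|F\|_L=0$ if $M$ is a single point). A map $F\in \mathrm{Lip}(M,Y)$ is called Lipschitz compact if the set $\big\{\tfrac{F(p)-F(q)}{d(p,q)} : p\neq q\big\}$ is relatively compact in $Y$. The pair $(M,Y)$ has the Lip-BPB property for Lipschitz compact maps if for every $\varepsilon>0$ there is $\eta(\varepsilon)>0$ such that for every Lipschitz compact $F\in\mathrm{Lip}(M,Y)$ with $\|F\|_L=1$ and all $p\neq q$ in $M$ with $\|F(p)-F(q)\|>(1-\eta(\varepsilon))\,d(p,q)$, there exist a Lipschitz compact $G\in\mathrm{Lip}(M,Y)$ and $r\ne s$ in $M$ with $$\frac{\|G(r)-G(s)\|}{d(r,s)}=\|G\|_L=1,\qquad \|G-F\|_L<\varepsilon,\qquad \frac{d(p,r)+d(q,s)}{d(p,q)}<\varepsilon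 .$$ Suppose that $(M,Y)$ has the Lip-BPB property for Lipschitz compact maps. Then: 1. For every compact Hausdorff space $K$, the pair $(M,C(K,Y))$ has the Lip-BPB property for Lipschitz compact maps. 2. For every $1\le p<\infty$, if $(M,\ell_p(Y))$ has the Lip-BPB property for Lipschitz compact maps, then so does $(M,L_p(\mu,Y))$ for every positive measure $\mu$. 3. For every $\sigma$-finite positive measure $\mu$, the pair $(M,L_\infty(\mu,Y))$ has the Lip-BPB property for Lipschitz compact maps. Here $C(K,Y)$ carries the supremum norm, $\ell_p(Y)$ is the space of $p$-summable sequences in $Y$, and $L_p(\mu,Y)$, $L_\infty(\mu,Y)$ are the Lebesgue-Bochner spaces of (classes of) strongly measurable functions. -/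

import Mathlib

open MeasureTheory
open scoped ENNReal NNReal

/-- `Lip(M, Y)`: the vector space of Lipschitz maps from the pointed metric space `(M, o)` to `Y`
that vanish at the base point `o`. -/
def LipZero {M : Type*} [MetricSpace M] (o : M) (Y : Type*) [NormedAddCommGroup Y]
    [NormedSpace ℝ Y] : Submodule ℝ (M → Y) where
  carrier := {F | (∃ C : ℝ≥0, LipschitzWith C F) ∧ F o = 0}
  zero_mem' := ⟨⟨0, LipschitzWith.const 0⟩, rfl⟩
  add_mem' := by
    rintro F G ⟨⟨C, hC⟩, hF⟩ ⟨⟨D, hD⟩, hG⟩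
    exact ⟨⟨C + D, hC.add hD⟩, by simp [hF, hG]⟩
  smul_mem' := by
    rintro c F ⟨⟨C, hC⟩, hF⟩
    refine ⟨⟨‖c‖₊ * C, (lipschitzWith_smul c).comp hC⟩, by simp [hF]⟩

/-- The Lipschitz norm `‖F‖_L = sup { ‖F p - F q‖ / d(p, q) : p ≠ q }` (the set is bounded above
when `F` is Lipschitz; the supremum is `0` when `M` is a single point). -/
noncomputable def lipNorm {M : Type*} [MetricSpace M] {Y : Type*} [NormedAddCommGroup Y]
    (F : M → Y) : ℝ :=
  sSup {t : ℝ | ∃ p q : M, p ≠ q ∧ t = ‖F p - F q‖ / dist p q}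

/-- The Lipschitz image `{ (F p - F q) / d(p, q) : p ≠ q } ⊆ Y` of `F`. -/
def lipImage {M : Type*} [MetricSpace M] {Y : Type*} [NormedAddCommGroup Y] [NormedSpace ℝ Y]
    (F : M → Y) : Set Y :=
  {y : Y | ∃ p q : M, p ≠ q ∧ y = (dist p q)⁻¹ • (F p - F q)}

/-- `F ∈ Lip(M, Y)` is Lipschitz compact when its Lipschitz image is relatively compact. -/
def IsLipCompact {M : Type*} [MetricSpace M] {o : M} {Y : Type*} [NormedAddCommGroup Y]
    [NormedSpace ℝ Y] (F : LipZero o Y) : Prop :=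
  IsCompact (closure (lipImage (F : M → Y)))

/-- The pair `(M, Y)` has the Lipschitz Bishop-Phelps-Bollobás property for Lipschitz compact maps:
the given map and the approximating map are both Lipschitz compact. -/
def LipBPBCompact {M : Type*} [MetricSpace M] (o : M) (Y : Type*) [NormedAddCommGroup Y]
    [NormedSpace ℝ Y] : Prop :=
  ∀ ε : ℝ, 0 < ε → ∃ η : ℝ, 0 < η ∧
    ∀ F : LipZero o Y, IsLipCompact F → lipNorm (F : M → Y) = 1 →
      ∀ p q : M, p ≠ q → ‖(F : M → Y) p - (F : M → Y) q‖ > (1 - η) * dist p q →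
        ∃ G : LipZero o Y, IsLipCompact G ∧ ∃ r s : M, r ≠ s ∧
          ‖(G : M → Y) r - (G : M → Y) s‖ / dist r s = lipNorm (G : M → Y) ∧
          lipNorm (G : M → Y) = 1 ∧
          lipNorm ((G - F : LipZero o Y) : M → Y) < ε ∧
          (dist p r + dist q s) / dist p q < ε

/-! In each case a Lipschitz compact map into the large space `Z` is compared with one into a model
space `W`, where the property is known. All difference quotients of `F` lie in one compact set `A`,
so a single choice of operators serves them all: a contraction `T : Z → W` nearly preserves the norm
of the given quotient, and `R + J T` is nearly the identity on `A`. Normalize `T F`, take its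
norm-attaining approximation `G` from the property of `W`, and return to `Z` with `R F + J S G`. The
gluing bound `‖R z + J w‖ ≤ max ‖z‖ ‖w‖` keeps the Lipschitz norm at most 1, while `‖w‖ ≤ ‖R z + J
w‖` preserves attainment at the same pair `r, s`.

For `C(K, Y)` and `L∞` the model is `Y`: `T` evaluates at a peak point or averages over a set where
the functions of `A` barely oscillate, `J` spreads a vector over that place, `R` keeps the rest, and
`P` is the identity.

For `L_p` the model is `ℓ_p(Y)`, `T` averages over a finite partition, and `R = 0`. Here `J` sees
only finitely many coordinates, so `G` may lose its norm under `J`. The contraction `S` of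
`exists_contraction_preserving_norm` repairs this: it moves `G` into those coordinates without
lowering the attained norm. The result is combined in `LipBPBCompact.transfer`. -/

/-! ### Contractions onto an absolute summand -/

section Renorming

variable {W : Type*} [NormedAddCommGroup W] [NormedSpace ℝ W]

/-- If the range of the projection `P` is an absolute summand of `W` and the unit vector `y` is
within `ε < 1` of that range, there is a contraction of `W` onto the range of `P` which preserves
the norm of `y` and is within `ε` of the identity on that range. -/
theorem exists_contraction_preserving_norm (P : W →L[ℝ] W) (hP : ∀ w, P (P w) = P w)
    (habs : ∀ b w, P b = b → ‖b‖ ≤ ‖P w‖ → ‖b + (w - P w)‖ ≤ ‖w‖)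
    {y : W} (hy : ‖y‖ = 1) {ε : ℝ} (hyε : ‖y - P y‖ ≤ ε) (hε : ε < 1) :
    ∃ S : W →L[ℝ] W, (∀ w, ‖S w‖ ≤ ‖w‖) ∧ ‖S y‖ = 1 ∧ (∀ w, P (S w) = S w) ∧
      ∀ w, P w = w → ‖S w - w‖ ≤ ε * ‖w‖ := by
  obtain ⟨g, hg, hgy⟩ := exists_dual_vector ℝ y (by simp [hy])
  rw [hy] at hgy
  simp only [RCLike.ofReal_real_eq_id, id] at hgy
  have hgle : ∀ w, |g w| ≤ ‖w‖ := fun w => by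
    have := g.le_opNorm w
    rwa [hg, one_mul, Real.norm_eq_abs] at this
  -- `c` measures how much of the norming functional `g` lives on the range of `P`; it lies in `[1 -
  -- ε, 1]`.
  set c : ℝ := ‖g ∘L P‖ with hc
  have hc0 : 0 ≤ c := norm_nonneg _
  have hcle : ∀ w, |g (P w)| ≤ c * ‖w‖ := fun w => (g ∘L P).le_opNorm w
  -- Absoluteness allows `P a` to be replaced by any vector of the range of no larger norm, of
  -- either sign; optimizing `g` over these gives `c * ‖P a‖`.
  have key : ∀ a, c * ‖P a‖ + |g (a - P a)| ≤ ‖a‖ := by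
    intro a
    have main : ∀ b, P b = b → ‖b‖ ≤ ‖P a‖ → |g b| + |g (a - P a)| ≤ ‖a‖ := by
      intro b hb hba
      have h1 := (hgle _).trans (habs b a hb hba)
      have h2 := (hgle _).trans (habs (-b) a (by simp [hb]) (by simpa using hba))
      rw [map_add] at h1 h2
      rw [map_neg] at h2
      rcases abs_le.1 h1 with ⟨h3, h4⟩
      rcases abs_le.1 h2 with ⟨h5, h6⟩
      rcases abs_cases (g b) with ⟨h7, _⟩ | ⟨h7, _⟩ <;>
        rcases abs_cases (g (a - P a)) with ⟨h8, _⟩ | ⟨h8, _⟩ <;> rw [h7, h8] <;> linarith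
    have hq : |g (a - P a)| ≤ ‖a‖ := by simpa using main 0 (by simp) (by simp)
    by_cases hPa : ‖P a‖ = 0
    · simpa [hPa] using hq
    have hPa' : 0 < ‖P a‖ := lt_of_le_of_ne (norm_nonneg _) (Ne.symm hPa)
    have hcb : c ≤ (‖a‖ - |g (a - P a)|) / ‖P a‖ := by
      refine ContinuousLinearMap.opNorm_le_bound _
        (div_nonneg (sub_nonneg.2 hq) hPa'.le) fun b => ?_
      change |g (P b)| ≤ _
      by_cases hPb : ‖P b‖ = 0
      · have : P b = 0 := norm_eq_zero.1 hPb
        rw [this, map_zero, abs_zero]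
        exact mul_nonneg (div_nonneg (sub_nonneg.2 hq) hPa'.le) (norm_nonneg _)
      have hPb' : 0 < ‖P b‖ := lt_of_le_of_ne (norm_nonneg _) (Ne.symm hPb)
      -- `2 • P b` is the difference of `b` and its reflection, both of norm at most `‖b‖`.
      have hPble : ‖P b‖ ≤ ‖b‖ := by
        have h1 := habs (P b) b (hP b) le_rfl
        have h2 := habs (-P b) b (by simp [hP b]) (by simp)
        have h3 : ‖(P b + (b - P b)) - (-P b + (b - P b))‖ ≤ ‖b‖ + ‖b‖ :=
          (norm_sub_le _ _).trans (add_le_add h1 h2)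
        have h4 : (P b + (b - P b)) - (-P b + (b - P b)) = (2 : ℝ) • P b := by
          rw [two_smul]; abel
        rw [h4, norm_smul, Real.norm_eq_abs, abs_two] at h3
        linarith
      have h := main ((‖P a‖ / ‖P b‖) • P b) (by rw [map_smul, hP])
        (by rw [norm_smul, Real.norm_eq_abs, abs_of_pos (div_pos hPa' hPb'),
          div_mul_cancel₀ _ hPb])
      rw [map_smul, smul_eq_mul, abs_mul, abs_of_pos (div_pos hPa' hPb'), div_mul_eq_mul_div] at h
      have h1 : ‖P a‖ * |g (P b)| / ‖P b‖ ≤ ‖a‖ - |g (a - P a)| := by linarith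
      rw [div_le_iff₀ hPb'] at h1
      rw [div_mul_eq_mul_div, le_div_iff₀ hPa']
      nlinarith [mul_le_mul_of_nonneg_left hPble (sub_nonneg.2 hq)]
    rw [le_div_iff₀ hPa'] at hcb
    linarith
  have hPy : 0 < ‖P y‖ := by
    have := norm_sub_norm_le y (P y)
    linarith
  set u : W := ‖P y‖⁻¹ • P y with hu
  have hun : ‖u‖ = 1 := by
    rw [hu, norm_smul, norm_inv, norm_norm, inv_mul_cancel₀ hPy.ne']
  have hPu : P u = u := by rw [hu, map_smul, hP]
  have hc1 : c ≤ 1 := by simpa [hPu, hun] using key u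
  have hgq : |g (y - P y)| ≤ ε := (hgle _).trans hyε
  have hgs : g (P y) + g (y - P y) = 1 := by rw [← map_add, add_sub_cancel, hgy]
  have hcε : 1 - ε ≤ c := by
    have h1 := hcle y
    rw [hy, mul_one] at h1
    have := le_abs_self (g (P y))
    have := le_abs_self (g (y - P y))
    linarith
  -- The part of `w` off the range is not discarded: its `g`-value is carried in the direction `u`
  -- of `P y`. Then `S y` is at least `g (P y) + g (y - P y) = 1` times `u`.
  let S : W →L[ℝ] W := c • P + (g ∘L (ContinuousLinearMap.id ℝ W - P)).smulRight u
  have hS : ∀ w, S w = c • P w + g (w - P w) • u := fun w => by simp [S]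
  have hSle : ∀ w, ‖S w‖ ≤ ‖w‖ := fun w => by
    rw [hS]
    refine (norm_add_le _ _).trans ?_
    rw [norm_smul, norm_smul, hun, mul_one, Real.norm_eq_abs, Real.norm_eq_abs, abs_of_nonneg hc0]
    exact key w
  refine ⟨S, hSle, le_antisymm (hy ▸ hSle y) ?_, fun w => by simp [hS, hP, hPu], fun w hw => ?_⟩
  · have h1 : S y = (c * ‖P y‖ + g (y - P y)) • u := by
      rw [hS, add_smul, mul_smul, hu, smul_inv_smul₀ hPy.ne']
    rw [h1, norm_smul, hun, mul_one]
    refine le_trans ?_ (le_abs_self _)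
    have h2 := hcle (P y)
    rw [hP] at h2
    have := le_abs_self (g (P y))
    linarith
  · rw [hS, hw, sub_self, map_zero, zero_smul, add_zero]
    have : c • w - w = (c - 1) • w := by rw [sub_smul, one_smul]
    rw [this, norm_smul, Real.norm_eq_abs, abs_of_nonpos (by linarith)]
    exact mul_le_mul_of_nonneg_right (by linarith) (norm_nonneg _)

end Renorming

/-! ### Lipschitz norm, compactness and the transfer principle -/

section Lipschitz

variable {M : Type*} [MetricSpace M]

theorem lipNorm_le {Z : Type*} [NormedAddCommGroup Z] {F : M → Z} {C : ℝ} (hC : 0 ≤ C)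
    (h : ∀ p q, ‖F p - F q‖ ≤ C * dist p q) : lipNorm F ≤ C := by
  refine Real.sSup_le ?_ hC
  rintro t ⟨p, q, hpq, rfl⟩
  rw [div_le_iff₀ (dist_pos.2 hpq)]
  exact h p q

variable {o : M} {Z : Type*} [NormedAddCommGroup Z] [NormedSpace ℝ Z]

theorem LipZero.div_le_lipNorm (F : LipZero o Z) {p q : M} (hpq : p ≠ q) :
    ‖(F : M → Z) p - (F : M → Z) q‖ / dist p q ≤ lipNorm (F : M → Z) := by
  obtain ⟨⟨C, hC⟩, -⟩ := F.2
  refine le_csSup ⟨C, ?_⟩ ⟨p, q, hpq, rfl⟩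
  rintro t ⟨p, q, hpq, rfl⟩
  rw [div_le_iff₀ (dist_pos.2 hpq), ← dist_eq_norm]
  exact hC.dist_le_mul p q

theorem LipZero.norm_sub_le (F : LipZero o Z) (p q : M) :
    ‖(F : M → Z) p - (F : M → Z) q‖ ≤ lipNorm (F : M → Z) * dist p q := by
  rcases eq_or_ne p q with rfl | hpq
  · simp
  · exact (div_le_iff₀ (dist_pos.2 hpq)).1 (LipZero.div_le_lipNorm F hpq)

/-- Postcomposition of an element of `LipZero` with a continuous linear map. -/
def LipZero.postcomp {W : Type*} [NormedAddCommGroup W] [NormedSpace ℝ W] (T : Z →L[ℝ] W)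
    (F : LipZero o Z) : LipZero o W :=
  ⟨fun x => T ((F : M → Z) x), by
    obtain ⟨⟨C, hC⟩, h0⟩ := F.2
    exact ⟨⟨‖T‖₊ * C, T.lipschitz.comp hC⟩, by simp [h0]⟩⟩

@[simp]
theorem LipZero.postcomp_apply {W : Type*} [NormedAddCommGroup W] [NormedSpace ℝ W]
    (T : Z →L[ℝ] W) (F : LipZero o Z) (x : M) :
    (LipZero.postcomp T F : M → W) x = T ((F : M → Z) x) := rfl

theorem IsLipCompact.postcomp {W : Type*} [NormedAddCommGroup W] [NormedSpace ℝ W]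
    {F : LipZero o Z} (hF : IsLipCompact F) (T : Z →L[ℝ] W) : IsLipCompact (LipZero.postcomp T F) := by
  refine (hF.image T.continuous).closure_of_subset ?_
  rintro _ ⟨p, q, hpq, rfl⟩
  exact ⟨_, subset_closure ⟨p, q, hpq, rfl⟩, by simp⟩

theorem IsLipCompact.add {F G : LipZero o Z} (hF : IsLipCompact F) (hG : IsLipCompact G) :
    IsLipCompact (F + G) := by
  refine ((hF.prod hG).image continuous_add).closure_of_subset ?_
  rintro _ ⟨p, q, hpq, rfl⟩
  refine ⟨(_, _), ⟨subset_closure ⟨p, q, hpq, rfl⟩, subset_closure ⟨p, q, hpq, rfl⟩⟩, ?_⟩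
  simp only [← smul_add, Submodule.coe_add, Pi.add_apply]
  congr 1
  abel

/-- Transfer of the Lip-BPB property from `W` to `Z`, when every compact subset of `Z` is
approximately recovered from a contraction `T : Z → W` by means of operators `R`, `J` that glue
elements of `Z` and `W` along an absolute summand `P` of `W`. -/
theorem LipBPBCompact.transfer {W : Type*} [NormedAddCommGroup W] [NormedSpace ℝ W]
    (hW : LipBPBCompact o W)
    (h : ∀ A : Set Z, IsCompact A → ∀ f ∈ A, f ≠ 0 → ∀ δ : ℝ, 0 < δ →
      ∃ (T : Z →L[ℝ] W) (R : Z →L[ℝ] Z) (J : W →L[ℝ] Z) (P : W →L[ℝ] W),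
        (∀ w, P (P w) = P w) ∧ (∀ z, P (T z) = T z) ∧
        (∀ b w, P b = b → ‖b‖ ≤ ‖P w‖ → ‖b + (w - P w)‖ ≤ ‖w‖) ∧
        (∀ z, ‖T z‖ ≤ ‖z‖) ∧ ‖f‖ - δ ≤ ‖T f‖ ∧
        (∀ z w, ‖R z + J w‖ ≤ max ‖z‖ ‖w‖) ∧
        (∀ z w, P w = w → ‖w‖ ≤ ‖R z + J w‖) ∧
        ∀ g ∈ A, ‖R g + J (T g) - g‖ ≤ δ) :
    LipBPBCompact o Z := by
  intro ε hε
  -- The final error is at most `4 * e`, and `e ≤ 1 / 8` keeps `l` positive and `e < 1`.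
  set e : ℝ := min ε 1 / 8 with he
  have hm : 0 < min ε 1 := lt_min hε one_pos
  have he0 : 0 < e := by positivity
  have he1 : e ≤ 1 / 8 := by have := min_le_right ε 1; linarith
  have heε : 8 * e ≤ ε := by have := min_le_left ε 1; linarith
  obtain ⟨η', hη', H⟩ := hW e he0
  set η : ℝ := min η' e / 2 with hη
  have hm' : 0 < min η' e := lt_min hη' he0
  have hη0 : 0 < η := by positivity
  have hηη' : 2 * η ≤ η' := by have := min_le_left η' e; linarith
  have hηe : 2 * η ≤ e := by have := min_le_right η' e; linarith
  refine ⟨η, hη0, fun F hF hF1 p q hpq hFpq => ?_⟩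
  have hd : 0 < dist p q := dist_pos.2 hpq
  set f : Z := (dist p q)⁻¹ • ((F : M → Z) p - (F : M → Z) q) with hf
  have hfA : f ∈ closure (lipImage (F : M → Z)) := subset_closure ⟨p, q, hpq, rfl⟩
  have hfn : ‖f‖ = ‖(F : M → Z) p - (F : M → Z) q‖ / dist p q := by
    rw [hf, norm_smul, norm_inv, Real.norm_eq_abs, abs_of_pos hd, div_eq_inv_mul]
  have hf1 : 1 - η < ‖f‖ := by rw [hfn, lt_div_iff₀ hd]; exact hFpq
  have hf0 : f ≠ 0 := by
    rintro h0
    rw [h0, norm_zero] at hf1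
    linarith
  obtain ⟨T, R, J, P, hPP, hPT, habs, hT, hTf, hRJ, hJ, hA⟩ := h _ hF f hfA hf0 η hη0
  have hFle : ∀ u v, ‖(F : M → Z) u - (F : M → Z) v‖ ≤ dist u v := fun u v => by
    simpa [hF1] using LipZero.norm_sub_le F u v
  set TF : LipZero o W := LipZero.postcomp T F with hTF
  set l : ℝ := lipNorm (TF : M → W) with hl
  have hl1 : l ≤ 1 := lipNorm_le zero_le_one fun u v => by
    rw [one_mul, hTF, LipZero.postcomp_apply, LipZero.postcomp_apply, ← map_sub]
    exact (hT _).trans (hFle u v)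
  have hTfe : ‖T f‖ = ‖(TF : M → W) p - (TF : M → W) q‖ / dist p q := by
    rw [hf, map_smul, norm_smul, norm_inv, Real.norm_eq_abs, abs_of_pos hd, div_eq_inv_mul, map_sub]
    rfl
  have hTfl : ‖T f‖ ≤ l := hTfe ▸ LipZero.div_le_lipNorm TF hpq
  have hl2 : 1 - 2 * η < l := by linarith
  have hl0 : 0 < l := by linarith
  -- The property of `W` requires Lipschitz norm exactly 1, whereas `T F` only has norm `l` in `(1 -
  -- 2 * η, 1]`.
  set F₁ : LipZero o W := LipZero.postcomp (l⁻¹ • T) F with hF₁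
  have hF₁a : ∀ u, (F₁ : M → W) u = l⁻¹ • T ((F : M → Z) u) := fun u => by simp [hF₁]
  have hF₁le : ∀ u v, ‖(F₁ : M → W) u - (F₁ : M → W) v‖ =
      l⁻¹ * ‖(TF : M → W) u - (TF : M → W) v‖ := fun u v => by
    rw [hF₁a, hF₁a, ← smul_sub, norm_smul, norm_inv, Real.norm_eq_abs, abs_of_pos hl0]
    rfl
  have hF₁n : lipNorm (F₁ : M → W) = 1 := by
    refine le_antisymm (lipNorm_le zero_le_one fun u v => ?_) ?_
    · rw [hF₁le, one_mul, inv_mul_le_iff₀ hl0]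
      exact LipZero.norm_sub_le TF u v
    · have : l ≤ l * lipNorm (F₁ : M → W) := by
        refine lipNorm_le (mul_nonneg hl0.le ?_) fun u v => ?_
        · exact (div_nonneg (norm_nonneg _) dist_nonneg).trans (LipZero.div_le_lipNorm F₁ hpq)
        · have := LipZero.norm_sub_le F₁ u v
          rwa [hF₁le, inv_mul_le_iff₀ hl0, ← mul_assoc] at this
      nlinarith
  have hF₁pq : ‖(F₁ : M → W) p - (F₁ : M → W) q‖ > (1 - η') * dist p q := by
    rw [hF₁le]
    have h1 : (1 - 2 * η) * dist p q < ‖(TF : M → W) p - (TF : M → W) q‖ := by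
      rw [← lt_div_iff₀ hd, ← hTfe]; linarith
    have h2 : 1 ≤ l⁻¹ := (one_le_inv₀ hl0).2 hl1
    have h3 := le_mul_of_one_le_left (norm_nonneg ((TF : M → W) p - (TF : M → W) q)) h2
    nlinarith
  obtain ⟨G, hG, r, s, hrs, hGrs, hG1, hGF, hclose⟩ :=
    H F₁ (IsLipCompact.postcomp hF _) hF₁n p q hpq hF₁pq
  have hd' : 0 < dist r s := dist_pos.2 hrs
  have hGF' : ∀ u v, ‖((G : M → W) u - (G : M → W) v) -
      ((F₁ : M → W) u - (F₁ : M → W) v)‖ ≤ e * dist u v := fun u v => by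
    have h1 := LipZero.norm_sub_le (G - F₁) u v
    have h2 : ((G : M → W) u - (G : M → W) v) - ((F₁ : M → W) u - (F₁ : M → W) v) =
        ((G - F₁ : LipZero o W) : M → W) u - ((G - F₁ : LipZero o W) : M → W) v := by
      simp only [Submodule.coe_sub, Pi.sub_apply]; abel
    rw [h2]
    exact h1.trans (mul_le_mul_of_nonneg_right hGF.le dist_nonneg)
  have hPQ : ∀ w, ‖w - P w‖ ≤ ‖w‖ := fun w => by simpa using habs 0 w (by simp) (by simp)
  set y : W := (dist r s)⁻¹ • ((G : M → W) r - (G : M → W) s) with hy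
  have hyn : ‖y‖ = 1 := by
    rw [hy, norm_smul, norm_inv, Real.norm_eq_abs, abs_of_pos hd', ← div_eq_inv_mul, hGrs, hG1]
  -- `F₁` takes values in the range of `P`, so `1 - P` kills it and sees only `G - F₁`.
  have hyP : ‖y - P y‖ ≤ e := by
    set D := (F₁ : M → W) r - (F₁ : M → W) s with hD
    have hPD : P D = D := by
      rw [hD, hF₁a, hF₁a, map_sub, map_smul, map_smul, hPT, hPT]
    set E := (G : M → W) r - (G : M → W) s with hE
    have h1 : y - P y = (dist r s)⁻¹ • ((E - D) - P (E - D)) := by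
      rw [hy, map_smul, map_sub P E D, hPD, ← smul_sub]; congr 1; abel
    rw [h1, norm_smul, norm_inv, Real.norm_eq_abs, abs_of_pos hd', inv_mul_le_iff₀ hd', mul_comm]
    exact (hPQ _).trans (hGF' r s)
  obtain ⟨S, hS, hSy, hPS, hSP⟩ :=
    exists_contraction_preserving_norm P hPP habs hyn hyP (by linarith)
  set G' : LipZero o Z := LipZero.postcomp R F + LipZero.postcomp (J ∘L S) G with hG'
  have hG'a : ∀ u v, (G' : M → Z) u - (G' : M → Z) v =
      R ((F : M → Z) u - (F : M → Z) v) + J (S ((G : M → W) u - (G : M → W) v)) := fun u v => by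
    simp only [hG', Submodule.coe_add, Pi.add_apply, LipZero.postcomp_apply,
      ContinuousLinearMap.comp_apply, map_sub]
    abel
  have hG'le : lipNorm (G' : M → Z) ≤ 1 := lipNorm_le zero_le_one fun u v => by
    rw [hG'a, one_mul]
    refine (hRJ _ _).trans (max_le (hFle u v) ((hS _).trans ?_))
    simpa [hG1] using LipZero.norm_sub_le G u v
  have hG'rs : 1 ≤ ‖(G' : M → Z) r - (G' : M → Z) s‖ / dist r s := by
    rw [le_div_iff₀ hd', one_mul, hG'a]
    refine le_trans ?_ (hJ _ _ (hPS _))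
    have : (G : M → W) r - (G : M → W) s = dist r s • y := by
      rw [hy, smul_inv_smul₀ hd'.ne']
    rw [this, map_smul, norm_smul, hSy, mul_one, Real.norm_eq_abs]
    exact le_abs_self _
  have hG'1 : lipNorm (G' : M → Z) = 1 :=
    le_antisymm hG'le (hG'rs.trans (LipZero.div_le_lipNorm G' hrs))
  refine ⟨G', IsLipCompact.add (IsLipCompact.postcomp hF _) (IsLipCompact.postcomp hG _), r, s, hrs, ?_, hG'1, ?_, hclose.trans_le ?_⟩
  · exact le_antisymm (LipZero.div_le_lipNorm G' hrs) (hG'1 ▸ hG'rs)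
  · refine lt_of_le_of_lt (lipNorm_le (C := 4 * e) (by positivity) fun u v => ?_)
      (by linarith)
    rcases eq_or_ne u v with rfl | huv
    · simp
    have hd'' : 0 < dist u v := dist_pos.2 huv
    set z := (F : M → Z) u - (F : M → Z) v with hz
    set E := (G : M → W) u - (G : M → W) v with hE
    set D := (F₁ : M → W) u - (F₁ : M → W) v with hD
    have hDz : T z = l • D := by
      rw [hD, hF₁a, hF₁a, ← smul_sub, smul_inv_smul₀ hl0.ne', ← map_sub]
    have hPD : P D = D := by
      rw [hD, hF₁a, hF₁a, map_sub, map_smul, map_smul, hPT, hPT]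
    have hDn : ‖D‖ ≤ dist u v := by simpa [hF₁n] using LipZero.norm_sub_le F₁ u v
    -- Four errors: recovery of `z`, `G` against `F₁`, `S` against the identity on the range of `P`,
    -- and the normalization by `l`.
    have h1 : ((G' - F : LipZero o Z) : M → Z) u - ((G' - F : LipZero o Z) : M → Z) v =
        (R z + J (T z) - z) + J (S (E - D) + (S D - D) + (1 - l) • D) := by
      have : ((G' - F : LipZero o Z) : M → Z) u - ((G' - F : LipZero o Z) : M → Z) v =
          ((G' : M → Z) u - (G' : M → Z) v) - z := by
        simp only [Submodule.coe_sub, Pi.sub_apply, hz]; abel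
      rw [this, hG'a, hDz, ← hz, ← hE, sub_smul, one_smul]
      simp only [map_add, map_sub]
      abel
    have hJn : ∀ w, ‖J w‖ ≤ ‖w‖ := fun w => by simpa using hRJ 0 w
    have h2 : ‖R z + J (T z) - z‖ ≤ η * dist u v := by
      have h3 := hA _ (subset_closure ⟨u, v, huv, rfl⟩)
      have h4 : R z + J (T z) - z = dist u v • (R ((dist u v)⁻¹ • z) +
          J (T ((dist u v)⁻¹ • z)) - (dist u v)⁻¹ • z) := by
        simp only [map_smul, ← smul_add, ← smul_sub, smul_inv_smul₀ hd''.ne']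
      rw [h4, norm_smul, Real.norm_eq_abs, abs_of_pos hd'', mul_comm]
      exact mul_le_mul_of_nonneg_right h3 hd''.le
    have h5 : ‖S (E - D)‖ ≤ e * dist u v := (hS _).trans (hGF' u v)
    have h6 : ‖S D - D‖ ≤ e * dist u v :=
      (hSP D hPD).trans (mul_le_mul_of_nonneg_left hDn he0.le)
    have h7 : ‖(1 - l) • D‖ ≤ e * dist u v := by
      rw [norm_smul, Real.norm_eq_abs, abs_of_nonneg (by linarith)]
      exact mul_le_mul (by linarith) hDn (norm_nonneg _) he0.le
    rw [h1]
    have h8 := norm_add_le (R z + J (T z) - z) (J (S (E - D) + (S D - D) + (1 - l) • D))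
    have h9 := hJn (S (E - D) + (S D - D) + (1 - l) • D)
    have h10 := norm_add₃_le (a := S (E - D)) (b := S D - D) (c := (1 - l) • D)
    have h11 := mul_le_mul_of_nonneg_right (show η ≤ e by linarith) hd''.le
    linarith
  · linarith

end Lipschitz

/-! ### Continuous functions on a compact space -/

section ContinuousMaps

variable {Y : Type*} [NormedAddCommGroup Y]
variable {K : Type*} [TopologicalSpace K] [CompactSpace K]

/-- Equicontinuity of a compact family at `t₀`, via a finite `δ / 3`-net. -/
theorem IsCompact.eventually_forall_norm_sub_le {A : Set C(K, Y)} (hA : IsCompact A) (t₀ : K)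
    {δ : ℝ} (hδ : 0 < δ) : ∀ᶠ t in nhds t₀, ∀ g ∈ A, ‖g t₀ - g t‖ ≤ δ := by
  obtain ⟨N, -, hN, hAN⟩ := hA.finite_cover_balls (show 0 < δ / 3 by positivity)
  have h : ∀ᶠ t in nhds t₀, ∀ n ∈ N, dist (n t) (n t₀) < δ / 3 :=
    (Filter.eventually_all_finite hN).2 fun n _ =>
      Metric.tendsto_nhds.1 (n.continuous.tendsto t₀) _ (by positivity)
  filter_upwards [h] with t ht g hg
  obtain ⟨n, hn, hgn⟩ := Set.mem_iUnion₂.1 (hAN hg)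
  rw [Metric.mem_ball] at hgn
  have h1 := ContinuousMap.dist_apply_le_dist (f := g) (g := n) t
  have h2 := ContinuousMap.dist_apply_le_dist (f := g) (g := n) t₀
  have h3 := ht n hn
  rw [← dist_eq_norm]
  have h4 := dist_triangle4 (g t₀) (n t₀) (n t) (g t)
  rw [dist_comm (n t₀), dist_comm (n t) (g t)] at h4
  linarith

variable [NormedSpace ℝ Y]

theorem norm_convexComb_le {c : ℝ} (hc : c ∈ Set.Icc (0 : ℝ) 1) {x y : Y} {m : ℝ} (hx : ‖x‖ ≤ m)
    (hy : ‖y‖ ≤ m) : ‖(1 - c) • x + c • y‖ ≤ m := by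
  refine (norm_add_le _ _).trans ?_
  rw [norm_smul, norm_smul, Real.norm_eq_abs, Real.norm_eq_abs, abs_of_nonneg hc.1,
    abs_of_nonneg (sub_nonneg.2 hc.2)]
  have h1 := mul_le_mul_of_nonneg_left hx (sub_nonneg.2 hc.2)
  have h2 := mul_le_mul_of_nonneg_left hy hc.1
  linarith

/-- Multiplication by a fixed continuous scalar function on `C(K, Y)`. -/
noncomputable def ContinuousMap.mulLeftCLM (φ : C(K, ℝ)) : C(K, Y) →L[ℝ] C(K, Y) :=
  LinearMap.mkContinuous
    { toFun := fun z => φ • z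
      map_add' := fun a b => by ext; simp
      map_smul' := fun c a => by ext t; simp [smul_comm c] } ‖φ‖ fun z => by
    refine (ContinuousMap.norm_le _ (by positivity)).2 fun t => ?_
    change ‖φ t • z t‖ ≤ _
    rw [norm_smul]
    exact mul_le_mul (φ.norm_coe_le_norm t) (z.norm_coe_le_norm t) (norm_nonneg _) (norm_nonneg _)

@[simp]
theorem ContinuousMap.mulLeftCLM_apply (φ : C(K, ℝ)) (z : C(K, Y)) (t : K) :
    ContinuousMap.mulLeftCLM φ z t = φ t • z t := rfl

/-- The inclusion of `Y` into `C(K, Y)` as the constant functions. -/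
noncomputable def ContinuousMap.constCLM : Y →L[ℝ] C(K, Y) :=
  LinearMap.mkContinuous
    { toFun := fun y => ContinuousMap.const K y
      map_add' := fun a b => by ext; simp
      map_smul' := fun c a => by ext t; simp } 1 fun y =>
    (ContinuousMap.norm_le _ (by positivity)).2 fun t => by simp

@[simp]
theorem ContinuousMap.constCLM_apply (y : Y) (t : K) :
    (ContinuousMap.constCLM y : C(K, Y)) t = y := rfl

theorem LipBPBCompact.continuousMap {M : Type*} [MetricSpace M] {o : M} [T2Space K]
    (hY : LipBPBCompact o Y) : LipBPBCompact o C(K, Y) := by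
  refine hY.transfer fun A hA f _ hf0 δ hδ => ?_
  have hK : Nonempty K := by
    by_contra hK
    rw [not_nonempty_iff] at hK
    exact hf0 (by ext t; exact hK.elim t)
  obtain ⟨t₀, -, ht₀⟩ := isCompact_univ.exists_isMaxOn Set.univ_nonempty
    (f.continuous.norm.continuousOn)
  have hft₀ : ‖f‖ ≤ ‖f t₀‖ :=
    (ContinuousMap.norm_le _ (norm_nonneg _)).2 fun t => ht₀ (Set.mem_univ t)
  obtain ⟨U, hU, hUo, ht₀U⟩ := mem_nhds_iff.1 (hA.eventually_forall_norm_sub_le t₀ hδ)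
  -- An Urysohn bump at the peak `t₀` of `f`, vanishing off `U`: gluing is then the pointwise convex
  -- combination `(1 - φ) z + φ w`, equal to `w` at `t₀`.
  obtain ⟨φ, hφ0, hφ1, hφ⟩ := exists_continuous_zero_one_of_isClosed hUo.isClosed_compl
    (isClosed_singleton (x := t₀)) (by simpa using ht₀U)
  have hφt₀ : φ t₀ = 1 := hφ1 rfl
  refine ⟨ContinuousMap.evalCLM ℝ t₀, ContinuousMap.mulLeftCLM (1 - φ),
    ContinuousMap.mulLeftCLM φ ∘L ContinuousMap.constCLM, ContinuousLinearMap.id ℝ Y,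
    fun _ => rfl, fun _ => rfl, fun b w _ h => by simpa using h,
    fun z => z.norm_coe_le_norm t₀, ?_, fun z w => ?_, fun z w _ => ?_, fun g hg => ?_⟩
  · change _ ≤ ‖f t₀‖
    linarith
  · refine (ContinuousMap.norm_le _ (by positivity)).2 fun t => ?_
    simpa using norm_convexComb_le (hφ t) ((z.norm_coe_le_norm t).trans (le_max_left _ ‖w‖))
      (le_max_right ‖z‖ ‖w‖)
  · refine le_trans ?_ (ContinuousMap.norm_coe_le_norm _ t₀)
    simp [hφt₀]
  · refine (ContinuousMap.norm_le _ hδ.le).2 fun t => ?_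
    have h1 : (ContinuousMap.mulLeftCLM (1 - φ) g + (ContinuousMap.mulLeftCLM φ ∘L
        ContinuousMap.constCLM) (ContinuousMap.evalCLM ℝ t₀ g) - g) t = φ t • (g t₀ - g t) := by
      simp [sub_smul, smul_sub]
      abel
    rw [h1, norm_smul, Real.norm_eq_abs, abs_of_nonneg (hφ t).1]
    by_cases ht : t ∈ U
    · exact (mul_le_of_le_one_left (norm_nonneg _) (hφ t).2).trans (hU ht g hg)
    · rw [hφ0 ht]
      simpa using hδ.le

end ContinuousMaps

/-! ### Essentially bounded functions -/

section LpInfinity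

variable {Y : Type*} [NormedAddCommGroup Y]
variable {Ω : Type*} [MeasurableSpace Ω] {μ : Measure Ω}

theorem MeasureTheory.Lp.integrableOn_of_measure_ne_top {p : ℝ≥0∞} (hp : 1 ≤ p) (f : Lp Y p μ)
    {B : Set Ω} (hB : μ B ≠ ∞) : IntegrableOn f B μ := by
  have : IsFiniteMeasure (μ.restrict B) := ⟨by simpa using hB.lt_top⟩
  exact ((Lp.memLp f).restrict B).integrable hp

theorem MeasureTheory.Lp.norm_top_le {f : Lp Y ∞ μ} {C : ℝ} (hC : 0 ≤ C)
    (h : ∀ᵐ x ∂μ, ‖f x‖ ≤ C) : ‖f‖ ≤ C := by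
  rw [Lp.norm_def, eLpNorm_exponent_top]
  exact ENNReal.toReal_le_of_le_ofReal hC (eLpNormEssSup_le_of_ae_bound h)

theorem MeasureTheory.Lp.ae_norm_le_norm_top (f : Lp Y ∞ μ) : ∀ᵐ x ∂μ, ‖f x‖ ≤ ‖f‖ := by
  filter_upwards [ae_le_eLpNormEssSup (f := f) (μ := μ)] with x hx
  rw [Lp.norm_def, eLpNorm_exponent_top, ← toReal_enorm]
  exact ENNReal.toReal_mono (by simpa using Lp.eLpNorm_ne_top f) hx

/-- A separable range is covered by countably many small balls, so one of their preimages meets the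
current set in positive measure; treat the functions one at a time. -/
theorem exists_subset_forall_oscillation_le {N : Set (Ω → Y)} (hN : N.Finite)
    (hNm : ∀ g ∈ N, StronglyMeasurable g) {δ : ℝ} (hδ : 0 < δ) {S : Set Ω} (hS : MeasurableSet S)
    (hμS : μ S ≠ 0) :
    ∃ B ⊆ S, MeasurableSet B ∧ μ B ≠ 0 ∧ ∀ g ∈ N, ∃ y, ∀ x ∈ B, ‖g x - y‖ ≤ δ := by
  induction N, hN using Set.Finite.induction_on with
  | empty => exact ⟨S, subset_rfl, hS, hμS, by simp⟩
  | @insert g N _ _ ih =>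
    obtain ⟨B, hBS, hB, hμB, hBN⟩ := ih fun g hg => hNm g (Set.mem_insert_of_mem _ hg)
    have hg := hNm g (Set.mem_insert _ _)
    obtain ⟨c, hc, hgc⟩ := hg.isSeparable_range
    have hcov : B ⊆ ⋃ y ∈ c, B ∩ {x | ‖g x - y‖ ≤ δ} := fun x hx => by
      obtain ⟨y, hy, hxy⟩ := Metric.mem_closure_iff.1 (hgc ⟨x, rfl⟩) δ hδ
      rw [dist_eq_norm] at hxy
      exact Set.mem_biUnion hy ⟨hx, hxy.le⟩
    obtain ⟨y, -, hy⟩ : ∃ y ∈ c, μ (B ∩ {x | ‖g x - y‖ ≤ δ}) ≠ 0 := by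
      by_contra! h
      exact hμB (measure_mono_null hcov ((measure_biUnion_null_iff hc).2 h))
    refine ⟨B ∩ {x | ‖g x - y‖ ≤ δ}, Set.inter_subset_left.trans hBS, hB.inter ?_, hy, ?_⟩
    · exact (hg.sub stronglyMeasurable_const).norm.measurable measurableSet_Iic
    · rintro h (rfl | hh)
      · exact ⟨y, fun x hx => hx.2⟩
      · obtain ⟨z, hz⟩ := hBN h hh
        exact ⟨z, fun x hx => hz x hx.1⟩

variable [NormedSpace ℝ Y]

/-- Integration over a set of finite measure as a linear map on `Lp`. -/
noncomputable def MeasureTheory.Lp.setIntegralₗ (p : ℝ≥0∞) [hp : Fact (1 ≤ p)] {B : Set Ω}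
    (hB : μ B ≠ ∞) : Lp Y p μ →ₗ[ℝ] Y where
  toFun f := ∫ x in B, f x ∂μ
  map_add' f g := by
    rw [← integral_add (Lp.integrableOn_of_measure_ne_top hp.out f hB)
      (Lp.integrableOn_of_measure_ne_top hp.out g hB)]
    exact integral_congr_ae (ae_restrict_of_ae (Lp.coeFn_add f g))
  map_smul' c f := by
    rw [RingHom.id_apply, ← integral_smul]
    exact integral_congr_ae (ae_restrict_of_ae (Lp.coeFn_smul c f))

/-- Restriction to a measurable set, extended by zero, on `L∞`. -/
noncomputable def MeasureTheory.Lp.topIndicatorCLM {B : Set Ω} (hB : MeasurableSet B) :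
    Lp Y ∞ μ →L[ℝ] Lp Y ∞ μ :=
  LinearMap.mkContinuous
    { toFun := fun f => ((Lp.memLp f).indicator hB).toLp
      map_add' := fun f g => by
        rw [← MemLp.toLp_add]
        refine MemLp.toLp_congr _ _ ?_
        filter_upwards [Lp.coeFn_add f g] with x hx
        by_cases h : x ∈ B
        · simpa [h] using hx
        · simp [h]
      map_smul' := fun c f => by
        rw [RingHom.id_apply, ← MemLp.toLp_const_smul]
        refine MemLp.toLp_congr _ _ ?_
        filter_upwards [Lp.coeFn_smul c f] with x hx
        by_cases h : x ∈ B
        · simpa [h] using hx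
        · simp [h] } 1 fun f => by
    refine Lp.norm_top_le (by positivity) ?_
    filter_upwards [((Lp.memLp f).indicator hB).coeFn_toLp, Lp.ae_norm_le_norm_top f] with x h1 h2
    change ‖(MemLp.toLp _ ((Lp.memLp f).indicator hB) : Lp Y ∞ μ) x‖ ≤ _
    rw [h1, one_mul]
    exact (norm_indicator_le_norm_self _ _).trans h2

theorem MeasureTheory.Lp.coeFn_topIndicatorCLM {B : Set Ω} (hB : MeasurableSet B)
    (f : Lp Y ∞ μ) : Lp.topIndicatorCLM hB f =ᵐ[μ] B.indicator f :=
  ((Lp.memLp f).indicator hB).coeFn_toLp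

/-- The inclusion of `Y` into `L∞` as the constant functions. -/
noncomputable def MeasureTheory.Lp.topConstCLM : Y →L[ℝ] Lp Y ∞ μ :=
  LinearMap.mkContinuous
    { toFun := fun y => (memLp_top_const y).toLp
      map_add' := fun _ _ => rfl
      map_smul' := fun _ _ => rfl } 1 fun y => by
    refine Lp.norm_top_le (by positivity) ?_
    filter_upwards [(memLp_top_const (μ := μ) y).coeFn_toLp] with x h1
    change ‖(MemLp.toLp _ (memLp_top_const y) : Lp Y ∞ μ) x‖ ≤ _
    rw [h1, one_mul]

theorem MeasureTheory.Lp.coeFn_topConstCLM (y : Y) :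
    (Lp.topConstCLM y : Lp Y ∞ μ) =ᵐ[μ] fun _ => y :=
  (memLp_top_const y).coeFn_toLp

theorem norm_setAverage_sub_le {p : ℝ≥0∞} (hp : 1 ≤ p) (f : Lp Y p μ) [CompleteSpace Y] {B : Set Ω}
    (hB : μ B ≠ ∞) (hB0 : μ B ≠ 0) {y : Y} {δ : ℝ} (h : ∀ᵐ x ∂μ, x ∈ B → ‖f x - y‖ ≤ δ) :
    ‖(μ.real B)⁻¹ • ∫ x in B, f x ∂μ - y‖ ≤ δ := by
  have hm : 0 < μ.real B := ENNReal.toReal_pos hB0 hB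
  have h1 : (μ.real B)⁻¹ • ∫ x in B, f x ∂μ - y = (μ.real B)⁻¹ • ∫ x in B, (f x - y) ∂μ := by
    rw [integral_sub (Lp.integrableOn_of_measure_ne_top hp f hB) (integrableOn_const hB),
      setIntegral_const, smul_sub, inv_smul_smul₀ hm.ne']
  rw [h1, norm_smul, norm_inv, Real.norm_eq_abs, abs_of_pos hm, inv_mul_le_iff₀ hm, mul_comm]
  exact norm_setIntegral_le_of_norm_le_const_ae' hB.lt_top h

theorem LipBPBCompact.lpTop {M : Type*} [MetricSpace M] {o : M} [CompleteSpace Y]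
    [SigmaFinite μ] (hY : LipBPBCompact o Y) : LipBPBCompact o (Lp Y ∞ μ) := by
  refine hY.transfer fun A hA f hfA hf0 δ hδ => ?_
  have hf : 0 < ‖f‖ := norm_pos_iff.2 hf0
  -- One `e` for the peak set of `f`, and `4 * e` for the distance from a value on `B` to the
  -- average (twice the oscillation bound `2 * e`).
  set e : ℝ := δ / 5 with he
  have he0 : 0 < e := by positivity
  set S : Set Ω := {x | ‖f‖ - e < ‖f x‖} with hS
  have hSm : MeasurableSet S := (Lp.stronglyMeasurable f).norm.measurable measurableSet_Ioi
  have hμS : μ S ≠ 0 := fun h => by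
    have h1 : ‖f‖ ≤ max (‖f‖ - e) 0 := by
      refine Lp.norm_top_le (le_max_right _ _) ?_
      filter_upwards [measure_eq_zero_iff_ae_notMem.1 h] with x hx
      exact (not_lt.1 hx).trans (le_max_left _ _)
    rcases le_max_iff.1 h1 with h1 | h1 <;> linarith
  obtain ⟨N, hNA, hN, hAN⟩ := hA.finite_cover_balls he0
  obtain ⟨B', hB'S, hB'm, hB'0, hB'⟩ := exists_subset_forall_oscillation_le (μ := μ)
    (hN.image (fun g : Lp Y ∞ μ => (g : Ω → Y)))
    (by rintro _ ⟨g, -, rfl⟩; exact Lp.stronglyMeasurable g) he0 hSm hμS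
  -- Finite measure, obtained from σ-finiteness, makes averages over `B` meaningful.
  obtain ⟨B, hBm, hBB', hB0, hBt⟩ :=
    Measure.exists_subset_measure_lt_top hB'm (pos_iff_ne_zero.2 hB'0)
  have hosc : ∀ g ∈ A, ∃ y, ∀ᵐ x ∂μ, x ∈ B → ‖g x - y‖ ≤ 2 * e := by
    intro g hg
    obtain ⟨n, hn, hgn⟩ := Set.mem_iUnion₂.1 (hAN hg)
    rw [Metric.mem_ball, dist_eq_norm] at hgn
    obtain ⟨y, hy⟩ := hB' _ (Set.mem_image_of_mem _ hn)
    refine ⟨y, ?_⟩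
    filter_upwards [Lp.coeFn_sub g n, Lp.ae_norm_le_norm_top (g - n)] with x h1 h2 hx
    rw [h1, Pi.sub_apply] at h2
    have h3 := hy x (hBB' hx)
    have h4 := norm_sub_le_norm_sub_add_norm_sub (g x) (n x) y
    linarith
  have hm : 0 < μ.real B := ENNReal.toReal_pos hB0.ne' hBt.ne
  have hpt : ∀ {q : Ω → Prop}, (∀ᵐ x ∂μ, q x) → ∃ x ∈ B, q x := fun {q} hq => by
    by_contra! h
    exact hB0.ne' (measure_mono_null (fun x hx => h x hx) hq)
  let T : Lp Y ∞ μ →L[ℝ] Y :=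
    LinearMap.mkContinuous ((μ.real B)⁻¹ • Lp.setIntegralₗ ∞ hBt.ne) 1 fun z => by
      change ‖(μ.real B)⁻¹ • ∫ x in B, z x ∂μ‖ ≤ _
      have := norm_setAverage_sub_le le_top z hBt.ne hB0.ne' (y := 0) (δ := ‖z‖) (by
        filter_upwards [Lp.ae_norm_le_norm_top z] with x hx _
        simpa using hx)
      simpa using this
  have hTa : ∀ z, T z = (μ.real B)⁻¹ • ∫ x in B, z x ∂μ := fun z => rfl
  have hTn : ∀ z, ‖T z‖ ≤ ‖z‖ := fun z => by
    have := norm_setAverage_sub_le le_top z hBt.ne hB0.ne' (y := 0) (δ := ‖z‖) (by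
      filter_upwards [Lp.ae_norm_le_norm_top z] with x hx _
      simpa using hx)
    simpa [hTa] using this
  have hTosc : ∀ g ∈ A, ∀ᵐ x ∂μ, x ∈ B → ‖T g - g x‖ ≤ 4 * e := by
    intro g hg
    obtain ⟨y, hy⟩ := hosc g hg
    have h1 := norm_setAverage_sub_le le_top g hBt.ne hB0.ne' hy
    filter_upwards [hy] with x hx hxB
    have h2 := norm_sub_le_norm_sub_add_norm_sub (T g) y (g x)
    rw [norm_sub_rev y] at h2
    have := hx hxB
    rw [← hTa] at h1
    linarith
  have hcoe : ∀ (z : Lp Y ∞ μ) (w : Y), ∀ᵐ x ∂μ, (Lp.topIndicatorCLM hBm.compl z +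
      (Lp.topIndicatorCLM hBm ∘L Lp.topConstCLM) w : Lp Y ∞ μ) x =
        Bᶜ.indicator z x + B.indicator (fun _ => w) x := by
    intro z w
    filter_upwards [Lp.coeFn_add (Lp.topIndicatorCLM hBm.compl z)
      ((Lp.topIndicatorCLM hBm ∘L Lp.topConstCLM) w), Lp.coeFn_topIndicatorCLM hBm.compl z,
      Lp.coeFn_topIndicatorCLM hBm (Lp.topConstCLM w), Lp.coeFn_topConstCLM (μ := μ) w]
      with x h1 h2 h3 h4
    rw [h1, Pi.add_apply, h2, ContinuousLinearMap.comp_apply, h3]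
    by_cases hx : x ∈ B <;> simp [hx, h4]
  refine ⟨T, Lp.topIndicatorCLM hBm.compl, Lp.topIndicatorCLM hBm ∘L Lp.topConstCLM,
    ContinuousLinearMap.id ℝ Y, fun _ => rfl, fun _ => rfl, fun b w _ h => by simpa using h,
    hTn, ?_, fun z w => ?_, fun z w _ => ?_, fun g hg => ?_⟩
  · obtain ⟨x, hxB, hx⟩ := hpt (hTosc f hfA)
    have h1 : ‖f‖ - e < ‖f x‖ := hB'S (hBB' hxB)
    have h2 := norm_sub_norm_le (f x) (T f)
    rw [norm_sub_rev] at h2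
    have := hx hxB
    linarith
  · refine Lp.norm_top_le (by positivity) ?_
    filter_upwards [hcoe z w, Lp.ae_norm_le_norm_top z] with x h1 h2
    rw [h1]
    by_cases hx : x ∈ B <;> simp [hx, h2]
  · obtain ⟨x, hxB, h1, h2⟩ := hpt ((hcoe z w).and (Lp.ae_norm_le_norm_top
      (Lp.topIndicatorCLM hBm.compl z + (Lp.topIndicatorCLM hBm ∘L Lp.topConstCLM) w)))
    rw [h1] at h2
    simpa [hxB] using h2
  · refine Lp.norm_top_le hδ.le ?_
    filter_upwards [hcoe g (T g), hTosc g hg, Lp.coeFn_sub (Lp.topIndicatorCLM hBm.compl g +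
      (Lp.topIndicatorCLM hBm ∘L Lp.topConstCLM) (T g)) g] with x h1 h2 h3
    rw [h3, Pi.sub_apply, h1]
    by_cases hx : x ∈ B
    · have := h2 hx
      simp only [Set.mem_compl_iff, hx, not_true_eq_false, not_false_eq_true,
        Set.indicator_of_notMem, Set.indicator_of_mem, zero_add]
      linarith
    · simpa [hx] using hδ.le

end LpInfinity

/-! ### Finite sets of coordinates as absolute summands of `ℓ_p(Y)` -/

section LpTruncation

variable {Y : Type*} [NormedAddCommGroup Y] {p : ℝ≥0∞}

theorem lp.coeFn_sum_single_apply (v : ℕ → Y) (s : Finset ℕ) (k : ℕ) :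
    (∑ n ∈ s, lp.single (E := fun _ : ℕ => Y) p n (v n)) k = if k ∈ s then v k else 0 := by
  simp only [lp.coeFn_sum, lp.coeFn_single, Finset.sum_apply, Finset.sum_pi_single]

variable [NormedSpace ℝ Y] [hp : Fact (1 ≤ p)]

/-- The coordinate projection of `lp` onto a finite set of coordinates. -/
noncomputable def lp.truncateCLM (s : Finset ℕ) :
    lp (fun _ : ℕ => Y) p →L[ℝ] lp (fun _ : ℕ => Y) p :=
  ∑ n ∈ s, lp.singleContinuousLinearMap ℝ (fun _ : ℕ => Y) p n ∘L
    lp.evalCLM ℝ (fun _ : ℕ => Y) p n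

theorem lp.truncateCLM_eq (s : Finset ℕ) (w : lp (fun _ : ℕ => Y) p) :
    lp.truncateCLM s w = ∑ n ∈ s, lp.single p n (w n) := by
  simp [lp.truncateCLM]
  rfl

theorem lp.truncateCLM_sum_single (s : Finset ℕ) (v : ℕ → Y) :
    lp.truncateCLM s (∑ n ∈ s, lp.single (E := fun _ : ℕ => Y) p n (v n)) =
      ∑ n ∈ s, lp.single (E := fun _ : ℕ => Y) p n (v n) := by
  rw [lp.truncateCLM_eq]
  refine Finset.sum_congr rfl fun n hn => ?_
  rw [lp.coeFn_sum_single_apply, if_pos hn]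

theorem lp.truncateCLM_idem (s : Finset ℕ) (w : lp (fun _ : ℕ => Y) p) :
    lp.truncateCLM s (lp.truncateCLM s w) = lp.truncateCLM s w := by
  conv_lhs => rw [lp.truncateCLM_eq s w]
  rw [lp.truncateCLM_sum_single s fun n => w n, lp.truncateCLM_eq]

theorem lp.norm_rpow_truncateCLM (hp_top : p ≠ ∞) (s : Finset ℕ) (w : lp (fun _ : ℕ => Y) p) :
    ‖lp.truncateCLM s w‖ ^ p.toReal = ∑ n ∈ s, ‖w n‖ ^ p.toReal := by
  rw [lp.truncateCLM_eq]
  exact lp.norm_sum_single (ENNReal.toReal_pos (one_pos.trans_le hp.out).ne' hp_top)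
    (fun n => w n) s

theorem lp.norm_rpow_eq_truncateCLM_add (hp_top : p ≠ ∞) (s : Finset ℕ)
    (w : lp (fun _ : ℕ => Y) p) :
    ‖w‖ ^ p.toReal = ‖lp.truncateCLM s w‖ ^ p.toReal + ‖w - lp.truncateCLM s w‖ ^ p.toReal := by
  have h := lp.norm_sub_norm_compl_sub_single
    (ENNReal.toReal_pos (one_pos.trans_le hp.out).ne' hp_top) w s
  rw [← lp.truncateCLM_eq, ← lp.norm_rpow_truncateCLM hp_top] at h
  linarith

/-- The `p`-th power of the norm is additive over complementary coordinates, hence monotone in each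
part. -/
theorem lp.norm_add_compl_truncateCLM_le (hp_top : p ≠ ∞) (s : Finset ℕ)
    {b w : lp (fun _ : ℕ => Y) p} (hb : lp.truncateCLM s b = b)
    (hbw : ‖b‖ ≤ ‖lp.truncateCLM s w‖) : ‖b + (w - lp.truncateCLM s w)‖ ≤ ‖w‖ := by
  have hp0 := ENNReal.toReal_pos (one_pos.trans_le hp.out).ne' hp_top
  rw [← Real.rpow_le_rpow_iff (norm_nonneg _) (norm_nonneg _) hp0,
    lp.norm_rpow_eq_truncateCLM_add hp_top s w, lp.norm_rpow_eq_truncateCLM_add hp_top s]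
  have h : lp.truncateCLM s (b + (w - lp.truncateCLM s w)) = b := by
    rw [map_add, map_sub, lp.truncateCLM_idem, sub_self, hb, add_zero]
  rw [h, add_sub_cancel_left]
  gcongr

end LpTruncation

/-! ### Averaging `L_p` over finite partitions -/

section Averaging

variable {Y : Type*} [NormedAddCommGroup Y]
variable {Ω : Type*} [MeasurableSpace Ω] {μ : Measure Ω} {p : ℝ≥0∞}

theorem MeasureTheory.Lp.enorm_rpow_eq_lintegral (hp0 : p ≠ 0) (hp_top : p ≠ ∞) (f : Lp Y p μ) :
    ‖f‖ₑ ^ p.toReal = ∫⁻ x, ‖f x‖ₑ ^ p.toReal ∂μ := by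
  rw [Lp.enorm_def, eLpNorm_eq_lintegral_rpow_enorm_toReal hp0 hp_top, ← ENNReal.rpow_mul,
    one_div, inv_mul_cancel₀ (ENNReal.toReal_pos hp0 hp_top).ne', ENNReal.rpow_one]

theorem enorm_rpow_eq_ofReal (y : Y) {r : ℝ} (hr : 0 ≤ r) : ‖y‖ₑ ^ r = ENNReal.ofReal (‖y‖ ^ r) := by
  rw [← ofReal_norm, ENNReal.ofReal_rpow_of_nonneg (norm_nonneg _) hr]

/-- A common refinement of finitely many partitions: the pair of two simple functions has finite
range, which can be coded by integers. -/
theorem exists_simpleFunc_nat_factor {N : Set (SimpleFunc Ω Y)} (hN : N.Finite) :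
    ∃ φ : SimpleFunc Ω ℕ, ∀ g ∈ N, ∃ c : ℕ → Y, ∀ x, g x = c (φ x) := by
  induction N, hN using Set.Finite.induction_on with
  | empty => exact ⟨SimpleFunc.const Ω 0, by simp⟩
  | @insert g N _ _ ih =>
    obtain ⟨φ, hφ⟩ := ih
    obtain ⟨e, he⟩ := Set.countable_iff_exists_injOn.1 (φ.pair g).finite_range.countable
    have hinv : ∀ x, Function.invFunOn e (Set.range (φ.pair g)) (e (φ x, g x)) = (φ x, g x) :=
      fun x => he.leftInvOn_invFunOn ⟨x, rfl⟩
    refine ⟨(φ.pair g).map e, ?_⟩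
    rintro h (rfl | hh)
    · refine ⟨fun n => (Function.invFunOn e (Set.range (φ.pair h)) n).2, fun x => ?_⟩
      simp [hinv]
    · obtain ⟨c, hc⟩ := hφ h hh
      refine ⟨fun n => c (Function.invFunOn e (Set.range (φ.pair g)) n).1, fun x => ?_⟩
      simp [hinv, hc]

variable [NormedSpace ℝ Y]

/-- Hölder on `B`. The factor is the average's `1 / μ B` times `(μ B)^(1/p)`, the `L_p` norm of the
indicator. -/
theorem enorm_rpow_smul_setIntegral_le (hp : 1 ≤ p) (hp_top : p ≠ ∞) (f : Lp Y p μ) {B : Set Ω}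
    (hB0 : μ B ≠ 0) (hB : μ B ≠ ∞) :
    ‖(μ.real B) ^ (p.toReal⁻¹ - 1) • ∫ x in B, f x ∂μ‖ₑ ^ p.toReal ≤
      ∫⁻ x in B, ‖f x‖ₑ ^ p.toReal ∂μ := by
  have hp0 : p ≠ 0 := (one_pos.trans_le hp).ne'
  have hr := ENNReal.toReal_pos hp0 hp_top
  have hm : 0 < μ.real B := ENNReal.toReal_pos hB0 hB
  have h1 : ‖∫ x in B, f x ∂μ‖ₑ ≤
      (∫⁻ x in B, ‖f x‖ₑ ^ p.toReal ∂μ) ^ (p.toReal⁻¹) * μ B ^ (1 - p.toReal⁻¹) := by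
    refine (enorm_integral_le_lintegral_enorm _).trans ?_
    have h := eLpNorm_le_eLpNorm_mul_rpow_measure_univ hp
      ((Lp.aestronglyMeasurable f).restrict (s := B))
    rwa [eLpNorm_one_eq_lintegral_enorm, eLpNorm_eq_lintegral_rpow_enorm_toReal hp0 hp_top,
      Measure.restrict_apply_univ, ENNReal.toReal_one, one_div_one, one_div] at h
  have h2 : ‖(μ.real B) ^ (p.toReal⁻¹ - 1)‖ₑ = μ B ^ (p.toReal⁻¹ - 1) := by
    rw [Real.enorm_eq_ofReal (by positivity), ← ENNReal.ofReal_rpow_of_pos hm,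
      ofReal_measureReal hB]
  calc ‖(μ.real B) ^ (p.toReal⁻¹ - 1) • ∫ x in B, f x ∂μ‖ₑ ^ p.toReal
      ≤ (μ B ^ (p.toReal⁻¹ - 1) * ((∫⁻ x in B, ‖f x‖ₑ ^ p.toReal ∂μ) ^ (p.toReal⁻¹) *
          μ B ^ (1 - p.toReal⁻¹))) ^ p.toReal := by
        rw [enorm_smul, h2]
        gcongr
    _ = ((∫⁻ x in B, ‖f x‖ₑ ^ p.toReal ∂μ) ^ (p.toReal⁻¹)) ^ p.toReal := by
        congr 1
        rw [mul_left_comm, ← ENNReal.rpow_add _ _ hB0 hB]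
        simp
    _ = _ := by rw [← ENNReal.rpow_mul, inv_mul_cancel₀ hr.ne', ENNReal.rpow_one]

/-- The simple function taking the normalized value `w n` on the level set `φ = n`, `n ∈ s`. -/
noncomputable def stepFunction (μ : Measure Ω) (φ : SimpleFunc Ω ℕ) (s : Finset ℕ)
    (w : lp (fun _ : ℕ => Y) p) : SimpleFunc Ω Y :=
  φ.map fun n => if n ∈ s then (μ.real (φ ⁻¹' {n})) ^ (-p.toReal⁻¹) • w n else 0

theorem stepFunction_apply (φ : SimpleFunc Ω ℕ) (s : Finset ℕ) (w : lp (fun _ : ℕ => Y) p)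
    (x : Ω) : stepFunction μ φ s w x =
      if φ x ∈ s then (μ.real (φ ⁻¹' {φ x})) ^ (-p.toReal⁻¹) • w (φ x) else 0 := rfl

theorem memLp_stepFunction (φ : SimpleFunc Ω ℕ) (s : Finset ℕ)
    (hs : ∀ n ∈ s, μ (φ ⁻¹' {n}) ≠ 0 ∧ μ (φ ⁻¹' {n}) ≠ ∞) (w : lp (fun _ : ℕ => Y) p) :
    MemLp (stepFunction μ φ s w) p μ := by
  refine SimpleFunc.memLp_of_finite_measure_preimage p fun y hy => ?_
  have hsub : stepFunction μ φ s w ⁻¹' {y} ⊆ ⋃ n ∈ s, φ ⁻¹' {n} := fun x hx => by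
    by_cases h : φ x ∈ s
    · exact Set.mem_biUnion h rfl
    · rw [Set.mem_preimage, stepFunction_apply, if_neg h] at hx
      exact absurd hx.symm hy
  exact (measure_mono hsub).trans_lt
    (measure_biUnion_lt_top s.finite_toSet fun n hn => (hs n hn).2.lt_top)

variable [hp : Fact (1 ≤ p)]

theorem norm_sum_single_setIntegral_le (hp_top : p ≠ ∞) (φ : SimpleFunc Ω ℕ) (s : Finset ℕ)
    (hs : ∀ n ∈ s, μ (φ ⁻¹' {n}) ≠ 0 ∧ μ (φ ⁻¹' {n}) ≠ ∞) (f : Lp Y p μ) :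
    ‖∑ n ∈ s, lp.single (E := fun _ : ℕ => Y) p n
      ((μ.real (φ ⁻¹' {n})) ^ (p.toReal⁻¹ - 1) • ∫ x in φ ⁻¹' {n}, f x ∂μ)‖ ≤ ‖f‖ := by
  have hp0 : p ≠ 0 := (one_pos.trans_le hp.out).ne'
  have hr := ENNReal.toReal_pos hp0 hp_top
  rw [← Real.rpow_le_rpow_iff (norm_nonneg _) (norm_nonneg _) hr]
  rw [lp.norm_sum_single (E := fun _ : ℕ => Y) hr (fun n =>
    (μ.real (φ ⁻¹' {n})) ^ (p.toReal⁻¹ - 1) • ∫ x in φ ⁻¹' {n}, f x ∂μ),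
    ← ENNReal.ofReal_le_ofReal_iff (by positivity),
    ENNReal.ofReal_sum_of_nonneg fun _ _ => by positivity, ← enorm_rpow_eq_ofReal _ hr.le,
    Lp.enorm_rpow_eq_lintegral hp0 hp_top]
  calc _ ≤ ∑ n ∈ s, ∫⁻ x in φ ⁻¹' {n}, ‖f x‖ₑ ^ p.toReal ∂μ :=
        Finset.sum_le_sum fun n hn => by
          rw [← enorm_rpow_eq_ofReal _ hr.le]
          exact enorm_rpow_smul_setIntegral_le hp.out hp_top f (hs n hn).1 (hs n hn).2
    _ = ∫⁻ x in ⋃ n ∈ s, φ ⁻¹' {n}, ‖f x‖ₑ ^ p.toReal ∂μ :=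
        (lintegral_biUnion_finset (fun i _ j _ hij =>
          Disjoint.preimage _ (by simpa using hij)) (fun n _ => φ.measurableSet_fiber n) _).symm
    _ ≤ _ := setLIntegral_le_lintegral _ _

/-- The normalized averages of a function in `Lp` over the level sets `φ = n`, `n ∈ s`, as an
element of `lp`. -/
noncomputable def MeasureTheory.Lp.averageLp (hp_top : p ≠ ∞) (φ : SimpleFunc Ω ℕ) (s : Finset ℕ)
    (hs : ∀ n ∈ s, μ (φ ⁻¹' {n}) ≠ 0 ∧ μ (φ ⁻¹' {n}) ≠ ∞) :
    Lp Y p μ →L[ℝ] lp (fun _ : ℕ => Y) p :=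
  LinearMap.mkContinuous
    { toFun := fun f => ∑ n ∈ s, lp.single p n
        ((μ.real (φ ⁻¹' {n})) ^ (p.toReal⁻¹ - 1) • ∫ x in φ ⁻¹' {n}, f x ∂μ)
      map_add' := fun f g => by
        rw [← Finset.sum_add_distrib]
        refine Finset.sum_congr rfl fun n hn => ?_
        have := (Lp.setIntegralₗ p (hs n hn).2).map_add f g
        rw [← lp.single_add, ← smul_add]
        exact congrArg (fun y => lp.single p n (_ • y)) this
      map_smul' := fun c f => by
        rw [RingHom.id_apply, Finset.smul_sum]
        refine Finset.sum_congr rfl fun n hn => ?_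
        have := (Lp.setIntegralₗ p (hs n hn).2).map_smul c f
        rw [← lp.single_smul, smul_comm c]
        exact congrArg (fun y => lp.single p n (_ • y)) this } 1 fun f =>
    (norm_sum_single_setIntegral_le hp_top φ s hs f).trans_eq (one_mul _).symm

theorem MeasureTheory.Lp.averageLp_eq (hp_top : p ≠ ∞) (φ : SimpleFunc Ω ℕ) (s : Finset ℕ)
    (hs : ∀ n ∈ s, μ (φ ⁻¹' {n}) ≠ 0 ∧ μ (φ ⁻¹' {n}) ≠ ∞) (f : Lp Y p μ) :
    Lp.averageLp hp_top φ s hs f = ∑ n ∈ s, lp.single p n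
      ((μ.real (φ ⁻¹' {n})) ^ (p.toReal⁻¹ - 1) • ∫ x in φ ⁻¹' {n}, f x ∂μ) := rfl

theorem MeasureTheory.Lp.norm_averageLp_le (hp_top : p ≠ ∞) (φ : SimpleFunc Ω ℕ) (s : Finset ℕ)
    (hs : ∀ n ∈ s, μ (φ ⁻¹' {n}) ≠ 0 ∧ μ (φ ⁻¹' {n}) ≠ ∞) (f : Lp Y p μ) :
    ‖Lp.averageLp hp_top φ s hs f‖ ≤ ‖f‖ :=
  norm_sum_single_setIntegral_le hp_top φ s hs f

theorem norm_toLp_stepFunction (hp_top : p ≠ ∞) (φ : SimpleFunc Ω ℕ) (s : Finset ℕ)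
    (hs : ∀ n ∈ s, μ (φ ⁻¹' {n}) ≠ 0 ∧ μ (φ ⁻¹' {n}) ≠ ∞) (w : lp (fun _ : ℕ => Y) p) :
    ‖(memLp_stepFunction φ s hs w).toLp‖ = ‖lp.truncateCLM s w‖ := by
  have hp0 : p ≠ 0 := (one_pos.trans_le hp.out).ne'
  have hr := ENNReal.toReal_pos hp0 hp_top
  refine (Real.rpow_left_inj (norm_nonneg _) (norm_nonneg _) hr.ne').1 ?_
  rw [← ENNReal.ofReal_eq_ofReal_iff (by positivity) (by positivity),
    lp.norm_rpow_truncateCLM hp_top, ENNReal.ofReal_sum_of_nonneg fun _ _ => by positivity,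
    ← enorm_rpow_eq_ofReal _ hr.le, Lp.enorm_rpow_eq_lintegral hp0 hp_top]
  set ψ : ℕ → Y := fun n => if n ∈ s then (μ.real (φ ⁻¹' {n})) ^ (-p.toReal⁻¹) • w n else 0
  have h1 : ∫⁻ x, ‖(MemLp.toLp _ (memLp_stepFunction φ s hs w) : Lp Y p μ) x‖ₑ ^ p.toReal ∂μ =
      ∫⁻ x, φ.map (fun n => ‖ψ n‖ₑ ^ p.toReal) x ∂μ := by
    refine lintegral_congr_ae ?_
    filter_upwards [(memLp_stepFunction φ s hs w).coeFn_toLp] with x hx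
    rw [hx]
    rfl
  rw [h1, SimpleFunc.lintegral_eq_lintegral, SimpleFunc.map_lintegral]
  have hsub : s ⊆ φ.range := fun n hn => by
    rw [SimpleFunc.mem_range]
    by_contra hnr
    exact (hs n hn).1 (by rw [Set.preimage_singleton_eq_empty.2 hnr, measure_empty])
  -- Levels outside `s` carry the value 0, so they contribute nothing even if their measure is
  -- infinite.
  rw [← Finset.sum_subset hsub fun n _ hn => by simp [ψ, hn, hr]]
  refine Finset.sum_congr rfl fun n hn => ?_
  have hm : 0 < μ.real (φ ⁻¹' {n}) := ENNReal.toReal_pos (hs n hn).1 (hs n hn).2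
  simp only [ψ, if_pos hn]
  rw [enorm_rpow_eq_ofReal _ hr.le, ← ofReal_measureReal (hs n hn).2,
    ← ENNReal.ofReal_mul (by positivity), norm_smul, Real.norm_eq_abs,
    abs_of_pos (by positivity), Real.mul_rpow (by positivity) (norm_nonneg _),
    ← Real.rpow_mul hm.le, neg_mul, inv_mul_cancel₀ hr.ne', Real.rpow_neg_one, mul_right_comm,
    inv_mul_cancel₀ hm.ne', one_mul]

/-- The embedding of the coordinates `n ∈ s` of `lp` into `Lp` as functions constant on the level
sets of `φ`. -/
noncomputable def MeasureTheory.Lp.stepCLM (hp_top : p ≠ ∞) (φ : SimpleFunc Ω ℕ) (s : Finset ℕ)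
    (hs : ∀ n ∈ s, μ (φ ⁻¹' {n}) ≠ 0 ∧ μ (φ ⁻¹' {n}) ≠ ∞) :
    lp (fun _ : ℕ => Y) p →L[ℝ] Lp Y p μ :=
  LinearMap.mkContinuous
    { toFun := fun w => (memLp_stepFunction φ s hs w).toLp
      map_add' := fun v w => by
        rw [← MemLp.toLp_add]
        refine MemLp.toLp_congr _ _ (.of_forall fun x => ?_)
        rw [Pi.add_apply, stepFunction_apply, stepFunction_apply, stepFunction_apply]
        split_ifs <;> simp
      map_smul' := fun c w => by
        rw [RingHom.id_apply, ← MemLp.toLp_const_smul]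
        refine MemLp.toLp_congr _ _ (.of_forall fun x => ?_)
        rw [Pi.smul_apply, stepFunction_apply, stepFunction_apply]
        split_ifs <;> simp [smul_comm c] } ‖lp.truncateCLM (Y := Y) (p := p) s‖ fun w =>
    (norm_toLp_stepFunction hp_top φ s hs w).le.trans ((lp.truncateCLM s).le_opNorm w)

theorem MeasureTheory.Lp.norm_stepCLM (hp_top : p ≠ ∞) (φ : SimpleFunc Ω ℕ) (s : Finset ℕ)
    (hs : ∀ n ∈ s, μ (φ ⁻¹' {n}) ≠ 0 ∧ μ (φ ⁻¹' {n}) ≠ ∞) (w : lp (fun _ : ℕ => Y) p) :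
    ‖Lp.stepCLM hp_top φ s hs w‖ = ‖lp.truncateCLM s w‖ :=
  norm_toLp_stepFunction hp_top φ s hs w

theorem MeasureTheory.Lp.coeFn_stepCLM (hp_top : p ≠ ∞) (φ : SimpleFunc Ω ℕ) (s : Finset ℕ)
    (hs : ∀ n ∈ s, μ (φ ⁻¹' {n}) ≠ 0 ∧ μ (φ ⁻¹' {n}) ≠ ∞) (w : lp (fun _ : ℕ => Y) p) :
    Lp.stepCLM hp_top φ s hs w =ᵐ[μ] stepFunction μ φ s w :=
  (memLp_stepFunction φ s hs w).coeFn_toLp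

theorem lp.norm_truncateCLM_le (hp_top : p ≠ ∞) (s : Finset ℕ) (w : lp (fun _ : ℕ => Y) p) :
    ‖lp.truncateCLM s w‖ ≤ ‖w‖ := by
  have hp0 := ENNReal.toReal_pos (one_pos.trans_le hp.out).ne' hp_top
  rw [← Real.rpow_le_rpow_iff (norm_nonneg _) (norm_nonneg _) hp0,
    lp.norm_rpow_eq_truncateCLM_add hp_top s w]
  exact le_add_of_nonneg_right (by positivity)

/-- Averaging fixes functions constant on the level sets. Omitted levels do no harm: null ones are
invisible, and on one of infinite measure an `L_p` function can only be 0. -/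
theorem MeasureTheory.Lp.stepCLM_averageLp [CompleteSpace Y] (hp_top : p ≠ ∞)
    (φ : SimpleFunc Ω ℕ) (s : Finset ℕ)
    (hs : ∀ n, n ∈ s ↔ μ (φ ⁻¹' {n}) ≠ 0 ∧ μ (φ ⁻¹' {n}) ≠ ∞) (f : Lp Y p μ) {c : ℕ → Y}
    (hf : ∀ᵐ x ∂μ, f x = c (φ x)) :
    Lp.stepCLM hp_top φ s (fun n hn => (hs n).1 hn)
      (Lp.averageLp hp_top φ s (fun n hn => (hs n).1 hn) f) = f := by
  have hp0 : p ≠ 0 := (one_pos.trans_le hp.out).ne'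
  refine Lp.ext ?_
  have hnull : ∀ᵐ x ∂μ, μ (φ ⁻¹' {φ x}) ≠ 0 := by
    have h : ∀ᵐ x ∂μ, ∀ n : ℕ, μ (φ ⁻¹' {n}) = 0 → x ∉ φ ⁻¹' {n} := ae_all_iff.2 fun n => by
      by_cases hn : μ (φ ⁻¹' {n}) = 0
      · filter_upwards [measure_eq_zero_iff_ae_notMem.1 hn] with x hx _ using hx
      · exact .of_forall fun x h => absurd h hn
    filter_upwards [h] with x hx h0 using hx _ h0 rfl
  have hcφ : MemLp (φ.map c) p μ := (Lp.memLp f).ae_eq (by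
    filter_upwards [hf] with x hx using hx)
  filter_upwards [hf, hnull, Lp.coeFn_stepCLM hp_top φ s (fun n hn => (hs n).1 hn)
    (Lp.averageLp hp_top φ s (fun n hn => (hs n).1 hn) f)] with x hx h0 h1
  rw [h1, hx, stepFunction_apply]
  by_cases hxs : φ x ∈ s
  · have htop := ((hs _).1 hxs).2
    have hm : 0 < μ.real (φ ⁻¹' {φ x}) := ENNReal.toReal_pos h0 htop
    have hint : ∫ z in φ ⁻¹' {φ x}, f z ∂μ = μ.real (φ ⁻¹' {φ x}) • c (φ x) := by
      rw [← setIntegral_const]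
      refine setIntegral_congr_ae (φ.measurableSet_fiber _) ?_
      filter_upwards [hf] with z hz hzx
      rw [hz, show φ z = φ x from hzx]
    rw [if_pos hxs, Lp.averageLp_eq, lp.coeFn_sum_single_apply (fun n =>
      (μ.real (φ ⁻¹' {n})) ^ (p.toReal⁻¹ - 1) • ∫ x in φ ⁻¹' {n}, f x ∂μ), if_pos hxs, hint,
      smul_smul, smul_smul, ← Real.rpow_add hm, ← Real.rpow_add_one hm.ne']
    rw [show -p.toReal⁻¹ + (p.toReal⁻¹ - 1) + 1 = 0 by ring, Real.rpow_zero, one_smul]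
  · have htop : μ (φ ⁻¹' {φ x}) = ∞ := by
      by_contra h
      exact hxs ((hs _).2 ⟨h0, h⟩)
    rw [if_neg hxs]
    by_contra hc
    refine (SimpleFunc.measure_preimage_lt_top_of_memLp hp0 hp_top (φ.map c) hcφ (c (φ x))
      (Ne.symm hc)).ne (top_le_iff.1 (htop ▸ measure_mono fun z hz => ?_))
    simp only [Set.mem_preimage, Set.mem_singleton_iff, SimpleFunc.map_apply] at hz ⊢
    rw [hz]

theorem LipBPBCompact.lpOfSequences {M : Type*} [MetricSpace M] {o : M} [CompleteSpace Y]
    (hp_top : p ≠ ∞) (hY : LipBPBCompact o (lp (fun _ : ℕ => Y) p)) :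
    LipBPBCompact o (Lp Y p μ) := by
  have hp0 : p ≠ 0 := (one_pos.trans_le hp.out).ne'
  refine hY.transfer fun A hA f hfA _ δ hδ => ?_
  -- Each `g ∈ A` is within `2 * e` of a simple function fixed by `J T`; since `J T` is a
  -- contraction, the error at most doubles.
  set e : ℝ := δ / 4 with he
  have he0 : 0 < e := by positivity
  obtain ⟨N, hNA, hN, hAN⟩ := hA.finite_cover_balls he0
  have hdense : ∀ g : Lp Y p μ, ∃ (u : SimpleFunc Ω Y) (hu : MemLp u p μ), ‖g - hu.toLp‖ ≤ e := by
    intro g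
    obtain ⟨u, hgu, hu⟩ := (Lp.memLp g).exists_simpleFunc_eLpNorm_sub_lt hp_top
      (ENNReal.ofReal_pos.2 he0).ne'
    refine ⟨u, hu, ?_⟩
    rw [Lp.norm_def]
    refine ENNReal.toReal_le_of_le_ofReal he0.le (le_of_eq_of_le (eLpNorm_congr_ae ?_) hgu.le)
    filter_upwards [Lp.coeFn_sub g hu.toLp, hu.coeFn_toLp] with x h1 h2
    rw [h1, Pi.sub_apply, Pi.sub_apply, h2]
  choose u hu hgu using hdense
  obtain ⟨φ, hφ⟩ := exists_simpleFunc_nat_factor (hN.image u)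
  classical
  set s : Finset ℕ := φ.range.filter fun n => μ (φ ⁻¹' {n}) ≠ 0 ∧ μ (φ ⁻¹' {n}) ≠ ∞ with hsdef
  have hs : ∀ n, n ∈ s ↔ μ (φ ⁻¹' {n}) ≠ 0 ∧ μ (φ ⁻¹' {n}) ≠ ∞ := fun n => by
    refine ⟨fun h => (Finset.mem_filter.1 h).2, fun h => Finset.mem_filter.2 ⟨?_, h⟩⟩
    rw [SimpleFunc.mem_range]
    by_contra hnr
    exact h.1 (by rw [Set.preimage_singleton_eq_empty.2 hnr, measure_empty])
  set T : Lp Y p μ →L[ℝ] lp (fun _ : ℕ => Y) p :=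
    Lp.averageLp hp_top φ s (fun n hn => (hs n).1 hn) with hT
  set J : lp (fun _ : ℕ => Y) p →L[ℝ] Lp Y p μ :=
    Lp.stepCLM hp_top φ s (fun n hn => (hs n).1 hn) with hJ
  have hTn : ∀ z, ‖T z‖ ≤ ‖z‖ := Lp.norm_averageLp_le hp_top φ s _
  have hJn : ∀ w, ‖J w‖ = ‖lp.truncateCLM s w‖ := Lp.norm_stepCLM hp_top φ s _
  have hJle : ∀ w, ‖J w‖ ≤ ‖w‖ := fun w => (hJn w).le.trans (lp.norm_truncateCLM_le hp_top s w)
  have happrox : ∀ g ∈ A, ‖J (T g) - g‖ ≤ δ := by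
    intro g hg
    obtain ⟨n, hn, hgn⟩ := Set.mem_iUnion₂.1 (hAN hg)
    rw [Metric.mem_ball, dist_eq_norm] at hgn
    obtain ⟨c, hc⟩ := hφ _ (Set.mem_image_of_mem u hn)
    have hfix : J (T (hu n).toLp) = (hu n).toLp :=
      Lp.stepCLM_averageLp hp_top φ s hs _ (c := c) (by
        filter_upwards [(hu n).coeFn_toLp] with x hx
        rw [hx, hc])
    have h1 : J (T g) - g = J (T (g - (hu n).toLp)) - (g - (hu n).toLp) := by
      rw [map_sub, map_sub, hfix]
      abel
    have h2 : ‖g - (hu n).toLp‖ ≤ 2 * e := by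
      have := norm_sub_le_norm_sub_add_norm_sub g n (hu n).toLp
      have := hgu n
      linarith
    rw [h1]
    have h3 := norm_sub_le (J (T (g - (hu n).toLp))) (g - (hu n).toLp)
    have h4 := (hJle _).trans (hTn (g - (hu n).toLp))
    linarith
  -- `J T` alone recovers `A`, so no complementary piece is needed; `J` is isometric on the range of
  -- the truncation.
  refine ⟨T, 0, J, lp.truncateCLM s, lp.truncateCLM_idem s,
    fun z => lp.truncateCLM_sum_single s _,
    fun b w hb h => lp.norm_add_compl_truncateCLM_le hp_top s hb h, hTn, ?_, fun z w => ?_,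
    fun z w hw => ?_, fun g hg => ?_⟩
  · have h1 := happrox f hfA
    have h2 := norm_sub_norm_le f (J (T f))
    rw [norm_sub_rev] at h2
    have := hJle (T f)
    linarith
  · simpa using Or.inr (hJle w)
  · simp [hJn, hw]
  · simpa using happrox g hg

end Averaging

theorem mainTheorem11 {M : Type*} [MetricSpace M] [CompleteSpace M] (o : M)
    {Y : Type*} [NormedAddCommGroup Y] [NormedSpace ℝ Y] [CompleteSpace Y]
    (hY : LipBPBCompact o Y) :
    (∀ (K : Type*) [TopologicalSpace K] [CompactSpace K] [T2Space K],
      LipBPBCompact o C(K, Y)) ∧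
    (∀ (p : ℝ≥0∞) [Fact (1 ≤ p)], p ≠ ∞ →
      LipBPBCompact o (lp (fun _ : ℕ => Y) p) →
      ∀ (Ω : Type*) [MeasurableSpace Ω] (μ : Measure Ω), LipBPBCompact o (Lp Y p μ)) ∧
    (∀ (Ω : Type*) [MeasurableSpace Ω] (μ : Measure Ω) [SigmaFinite μ],
      LipBPBCompact o (Lp Y ∞ μ)) :=
  ⟨fun _ => hY.continuousMap, fun _ _ hp h _ _ _ => h.lpOfSequences hp, fun _ _ _ _ => hY.lpTop⟩
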